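/- **Setting.** Let $\Omega=(r,s)\times(p,q)\subset\mathbb R^2$ with $r<s$, $p<q$, let $T>0$, $\varepsilon_0>0$, and let $\mu_0,\chi^{(1)},\chi^{(3)}\colon\Omega\to(0,\infty)$ belong to $L_\infty(\Omega)$. For a scalar field $u$ or a vector field $\mathbf u$ and a weight $\omega>0$ on $\Omega$ write $\|u\|_\omega=\big(\int_\Omega|u|^2\omega\,d\mathbf x\big)^{1/2}$. Consider the two-dimensional (TE mode) Maxwell system with Kerr nonlinearity in $\Omega\times(0,T)$ for $\mathbf E=(E_x,E_y)$ and $H_z$, with current density $\mathbf J=(J_x,J_y)$, $$\partial_tD_x=\partial_yH_z+J_x,\qquad \partial_tD_y=-\partial_xH_z+J_y,\qquad \mu_0\,\partial_tH_z=-\partial_xE_y+\partial_yE_x,$$ $$\partial_t\mathbf D=\varepsilon_0\Big((1+\chi^{(1)})\,\partial_t\mathbf E+\chi^{(3)}\big[|\mathbf E|^2+2\,\mathbf E\mathbf E^{T}\big]\partial_t\mathbf E\Big),$$ with the perfect electric conductor (PEC) boundary condition $E_x|_{y=p,q}=0$, $E_y|_{x=r,s}=0$ and initial values $E_x^0,E_y^0\in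 L^4(\Omega)$, $H_z^0\in L^2(\Omega)$; put $\mathbf E_0=(E_x^0,E_y^0)$. **Curl with PEC condition.** For $\Phi=(\Phi_x,\Phi_y)\in L^4(\Omega)^2$ and $c\in L^2(\Omega)$ we say that $\Phi$ satisfies the PEC condition with $\nabla\times\Phi=c$ (that is, $\Phi\in H_0(\mathrm{curl};\Omega)$ and its weak curl $\partial_x\Phi_y-\partial_y\Phi_x$ is $c$) if $$\int_\Omega c\,\psi\,d\mathbf x=\int_\Omega(\Phi_x\,\partial_y\psi-\Phi_y\,\partial_x\psi)\,d\mathbf x\qquad\text{for all }\psi\in C^\infty(\mathbb R^2).$$ Let $V$ be the space of all $\Phi\in L^4(\Omega)^2$ for which such a $c=\nabla\times\Phi\in L^2(\Omega)$ exists. **Weak solution.** A triple $(E_x,E_y,H_z)$ is a weak solution if $E_x,E_y\in C([0,T);L^4(\Omega))$ and $H_z\in C([0,T);L^2(\Omega))$ take the given initial values at $t=0$, if they are locally absolutely continuous on $(0,T)$ with locally Bochner integrable time derivatives $\partial_tE_x,\partial_tE_y\in L^1_{\mathrm{loc}}((0,T);L^4(\Omega))$, $\partial_tH_z\in L^1_{\mathrm{loc}}((0,T);L^2(\Omega))$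 (that is, $u(b)-u(a)=\int_a^b\partial_tu\,d\tau$ for $u=E_x,E_y,H_z$ and all $a,b\in(0,T)$; for instance $u\in C^1$ on $(0,T)$), and if for almost every $t\in(0,T)$, with $\partial_t\mathbf D$ given by the formula above, $\mathbf E(t)\in V$ and $$\int_\Omega\partial_t\mathbf D\cdot\Phi\,d\mathbf x=\int_\Omega H_z\,(\nabla\times\Phi)\,d\mathbf x+\int_\Omega\mathbf J\cdot\Phi\,d\mathbf x\quad\text{for all }\Phi\in V,$$ $$\int_\Omega\mu_0\,\partial_tH_z\,\Psi\,d\mathbf x=-\int_\Omega(\nabla\times\mathbf E)\,\Psi\,d\mathbf x\quad\text{for all }\Psi\in L^2(\Omega).$$ **Theorem (continuous energy conservation).** If $(E_x,E_y,H_z)$ is a weak solution in the case of no sources, i.e. $\mathbf J=0$, then the nonlinear electromagnetic energy $$\mathcal E(t)=\|\mathbf E(t)\|^2_{\varepsilon_0(1+\chi^{(1)})}+\|H_z(t)\|^2_{\mu_0}+\tfrac32\big\||\mathbf E(t)|^2\big\|^2_{\varepsilon_0\chi^{(3)}}$$ satisfies, for every $t\in[0,T)$, $$\mathcal E(t)=\mathcal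 E(0)=\|\mathbf E_0\|^2_{\varepsilon_0(1+\chi^{(1)})}+\|H_z^0\|^2_{\mu_0}+\tfrac32\big\||\mathbf E_0|^2\big\|^2_{\varepsilon_0\chi^{(3)}}.$$ -/

import Mathlib

open MeasureTheory Set
open scoped ENNReal ContDiff

namespace KerrTE

/-- The Hölder exponent `4` is at least `1`, so that `L⁴` is a normed space. -/
instance fact_one_le_four : Fact ((1 : ℝ≥0∞) ≤ 4) := ⟨by norm_num⟩

/-- The open rectangle `(r,s) × (p,q)`. -/
def rect (r s p q : ℝ) : Set (ℝ × ℝ) := Ioo r s ×ˢ Ioo p q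

/-- Real Lebesgue space `Lᵖ(Ω)` of a planar set. -/
abbrev LSpace (e : ℝ≥0∞) (Ω : Set (ℝ × ℝ)) : Type :=
  Lp ℝ e ((volume : Measure (ℝ × ℝ)).restrict Ω)

/-- The partial derivative `∂ₓψ`. -/
noncomputable def dx (ψ : ℝ × ℝ → ℝ) (z : ℝ × ℝ) : ℝ := fderiv ℝ ψ z (1, 0)

/-- The partial derivative `∂_yψ`. -/
noncomputable def dy (ψ : ℝ × ℝ → ℝ) (z : ℝ × ℝ) : ℝ := fderiv ℝ ψ z (0, 1)

/-- `(Φx, Φy)` has weak curl `c = ∂ₓΦy - ∂_yΦx` in `Ω` and vanishing tangential trace on the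
boundary of `Ω` (the perfect electric conductor condition `n × Φ = 0`): Green's formula holds
without a boundary term against every function that is smooth up to the boundary.
For `Φ ∈ L²` and `c ∈ L²` this says that `Φ ∈ H₀(curl; Ω)` with `curl Φ = c`. -/
def HasCurlPEC (Ω : Set (ℝ × ℝ)) (Φx Φy c : ℝ × ℝ → ℝ) : Prop :=
  ∀ ψ : ℝ × ℝ → ℝ, ContDiff ℝ ∞ ψ →
    ∫ z in Ω, c z * ψ z = ∫ z in Ω, (Φx z * dy ψ z - Φy z * dx ψ z)

/-- `u` is locally absolutely continuous on `(0,T)` with values in the Banach space `X`, and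
`u'` is its time derivative (`u ∈ W^{1,1}_loc((0,T); X)`, `∂ₜu = u'`). -/
def HasTimeDeriv {X : Type*} [NormedAddCommGroup X] [NormedSpace ℝ X]
    (T : ℝ) (u u' : ℝ → X) : Prop :=
  LocallyIntegrableOn u' (Ioo 0 T) volume ∧
    ∀ a ∈ Ioo 0 T, ∀ b ∈ Ioo 0 T, u b - u a = ∫ τ in a..b, u' τ

/-- The right-hand side of the constitutive equation for `∂ₜDx`, in terms of `E` and `∂ₜE`. -/
def dtDx (ε₀ : ℝ) (χ₁ χ₃ Ex Ey Ex' Ey' : ℝ × ℝ → ℝ) (z : ℝ × ℝ) : ℝ :=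
  ε₀ * ((1 + χ₁ z) * Ex' z
    + χ₃ z * ((Ex z ^ 2 + Ey z ^ 2) * Ex' z + 2 * (Ex z ^ 2 * Ex' z + Ex z * Ey z * Ey' z)))

/-- The right-hand side of the constitutive equation for `∂ₜDy`, in terms of `E` and `∂ₜE`. -/
def dtDy (ε₀ : ℝ) (χ₁ χ₃ Ex Ey Ex' Ey' : ℝ × ℝ → ℝ) (z : ℝ × ℝ) : ℝ :=
  ε₀ * ((1 + χ₁ z) * Ey' z
    + χ₃ z * ((Ex z ^ 2 + Ey z ^ 2) * Ey' z + 2 * (Ex z * Ey z * Ex' z + Ey z ^ 2 * Ey' z)))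

/-- `(Ex, Ey, Hz)` is a weak solution on `Ω × (0,T)` of
`∂ₜDx = ∂_yHz + Jx`, `∂ₜDy = -∂ₓHz + Jy`, `μ₀∂ₜHz = -∂ₓEy + ∂_yEx`,
with `∂ₜDx`, `∂ₜDy` given by the Kerr law, with the perfect electric conductor boundary
condition and with initial values `Ex₀, Ey₀, Hz₀`. -/
def IsWeakSolution (Ω : Set (ℝ × ℝ)) (T ε₀ : ℝ) (μ₀ χ₁ χ₃ : ℝ × ℝ → ℝ)
    (Jx Jy : ℝ → LSpace 2 Ω)
    (Ex₀ Ey₀ : LSpace 4 Ω) (Hz₀ : LSpace 2 Ω)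
    (Ex Ey : ℝ → LSpace 4 Ω) (Hz : ℝ → LSpace 2 Ω) : Prop :=
  -- continuity in time and initial conditions
  ContinuousOn Ex (Ico 0 T) ∧ ContinuousOn Ey (Ico 0 T) ∧ ContinuousOn Hz (Ico 0 T) ∧
  Ex 0 = Ex₀ ∧ Ey 0 = Ey₀ ∧ Hz 0 = Hz₀ ∧
  ∃ (Ex' Ey' : ℝ → LSpace 4 Ω) (Hz' : ℝ → LSpace 2 Ω),
    HasTimeDeriv T Ex Ex' ∧ HasTimeDeriv T Ey Ey' ∧ HasTimeDeriv T Hz Hz' ∧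
    ∀ᵐ t ∂(volume.restrict (Ioo 0 T)),
      -- the equations for `D`, tested with fields of vanishing tangential trace
      (∀ (Φx Φy : LSpace 4 Ω) (c : LSpace 2 Ω), HasCurlPEC Ω Φx Φy c →
        ∫ z in Ω, (dtDx ε₀ χ₁ χ₃ (Ex t) (Ey t) (Ex' t) (Ey' t) z * Φx z
            + dtDy ε₀ χ₁ χ₃ (Ex t) (Ey t) (Ex' t) (Ey' t) z * Φy z)
          = (∫ z in Ω, Hz t z * c z) + ∫ z in Ω, (Jx t z * Φx z + Jy t z * Φy z)) ∧
      -- the boundary condition for `E`, and the equation for `Hz`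
      ∃ curlE : LSpace 2 Ω, HasCurlPEC Ω (Ex t) (Ey t) curlE ∧
        ∀ Ψ : LSpace 2 Ω,
          ∫ z in Ω, μ₀ z * Hz' t z * Ψ z = - ∫ z in Ω, curlE z * Ψ z

/-- The weighted norm `‖f‖_w = (∫_Ω |f|² w)^{1/2}`. -/
noncomputable def wnorm (Ω : Set (ℝ × ℝ)) (w f : ℝ × ℝ → ℝ) : ℝ :=
  Real.sqrt (∫ z in Ω, |f z| ^ 2 * w z)

/-- The nonlinear electromagnetic energy
`‖E‖²_{ε₀(1+χ₁)} + ‖Hz‖²_{μ₀} + (3/2) ‖|E|²‖²_{ε₀χ₃}`. -/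
noncomputable def energy (Ω : Set (ℝ × ℝ)) (ε₀ : ℝ) (μ₀ χ₁ χ₃ Ex Ey Hz : ℝ × ℝ → ℝ) : ℝ :=
  wnorm Ω (fun z => ε₀ * (1 + χ₁ z)) (fun z => Real.sqrt (Ex z ^ 2 + Ey z ^ 2)) ^ 2
    + wnorm Ω μ₀ Hz ^ 2
    + 3 / 2 * wnorm Ω (fun z => ε₀ * χ₃ z) (fun z => Ex z ^ 2 + Ey z ^ 2) ^ 2

end KerrTE

/-! ### Absolutely continuous functions with values in normed spaces. -/

section AbsolutelyContinuous

open Filter AbsolutelyContinuousOnInterval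
open scoped Topology

/-! Testing the D-equation with E(t) and the H-equation with H(t) makes the two curl terms cancel.
The Kerr matrix |E|² + 2EEᵀ maps E to 3|E|²E, so ∂ₜD·E is half the rate of the electric energy
density (`integral_dtD_mul`, `energy_rate_eq_zero`). For rigour, the energy is built from bounded
bilinear maps, with |E|² in L² as a product of L⁴ functions. It therefore inherits absolute
continuity and the product rule from the fields; its derivative vanishes a.e., so it is constant on
(0,T), and continuity reaches t = 0. -/

/-- A continuous bilinear map sends a pair of absolutely continuous functions to an absolutely
continuous function. -/
theorem ContinuousLinearMap.absolutelyContinuousOnInterval_of_bilinear {X Y Z : Type*}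
    [NormedAddCommGroup X] [NormedSpace ℝ X] [NormedAddCommGroup Y] [NormedSpace ℝ Y]
    [NormedAddCommGroup Z] [NormedSpace ℝ Z] (B : X →L[ℝ] Y →L[ℝ] Z)
    {f : ℝ → X} {g : ℝ → Y} {a b : ℝ}
    (hf : AbsolutelyContinuousOnInterval f a b) (hg : AbsolutelyContinuousOnInterval g a b) :
    AbsolutelyContinuousOnInterval (fun t => B (f t) (g t)) a b := by
  obtain ⟨C, hC⟩ := hf.exists_bound
  obtain ⟨D, hD⟩ := hg.exists_bound
  unfold AbsolutelyContinuousOnInterval at hf hg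
  apply squeeze_zero' ?_ ?_
    (by simpa using (hg.const_mul (‖B‖ * C)).add (hf.const_mul (‖B‖ * D)))
  · exact .of_forall fun _ => Finset.sum_nonneg (fun i hi => dist_nonneg)
  rw [eventually_inf_principal]
  filter_upwards with (n, I) hnI
  simp only [Finset.mul_sum, ← Finset.sum_add_distrib]
  refine Finset.sum_le_sum fun i hi => ?_
  obtain ⟨h1, h2⟩ := hnI.1 i hi
  set s := (I i).1
  set t := (I i).2
  have hsplit : B (f s) (g s) - B (f t) (g t) = B (f s) (g s - g t) + B (f s - f t) (g t) := by
    simp only [map_sub, _root_.sub_apply]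
    abel
  rw [dist_eq_norm, dist_eq_norm, dist_eq_norm, hsplit]
  refine (norm_add_le _ _).trans (add_le_add ?_ ?_)
  · refine (B.le_opNorm₂ _ _).trans ?_
    gcongr
    exact hC _ h1
  · refine (B.le_opNorm₂ _ _).trans ?_
    rw [mul_right_comm]
    gcongr
    exact hD _ h2

/-- A function whose increments are integrals of an integrable function is absolutely
continuous. -/
theorem IntervalIntegrable.absolutelyContinuousOnInterval_of_sub_eq {X : Type*}
    [NormedAddCommGroup X] [NormedSpace ℝ X] {u u' : ℝ → X} {a b : ℝ}
    (hu' : IntervalIntegrable u' volume a b)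
    (hu : ∀ x ∈ uIcc a b, ∀ y ∈ uIcc a b, u y - u x = ∫ τ in x..y, u' τ) :
    AbsolutelyContinuousOnInterval u a b := by
  -- The scalar primitive of ‖u'‖ dominates the increments of u.
  have hG : AbsolutelyContinuousOnInterval (fun x => ∫ τ in a..x, ‖u' τ‖) a b :=
    hu'.norm.absolutelyContinuousOnInterval_intervalIntegral left_mem_uIcc
  unfold AbsolutelyContinuousOnInterval at hG ⊢
  refine squeeze_zero' ?_ ?_ hG
  · exact .of_forall fun _ => Finset.sum_nonneg (fun i hi => dist_nonneg)
  rw [eventually_inf_principal]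
  filter_upwards with (n, I) hnI
  refine Finset.sum_le_sum fun i hi => ?_
  obtain ⟨h1, h2⟩ := hnI.1 i hi
  have hint : ∀ x ∈ uIcc a b, IntervalIntegrable (fun τ => ‖u' τ‖) volume a x := fun x hx =>
    hu'.norm.mono_set (uIcc_subset_uIcc_left hx)
  rw [dist_comm, dist_eq_norm, hu _ h1 _ h2, dist_comm, Real.dist_eq,
    intervalIntegral.integral_interval_sub_left (hint _ h2) (hint _ h1)]
  exact intervalIntegral.norm_integral_le_abs_integral_norm

end AbsolutelyContinuous

namespace KerrTE

/-! ### Regularity in time of the fields. -/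

section TimeDerivative

variable {X : Type*} [NormedAddCommGroup X] [NormedSpace ℝ X] {T : ℝ} {u u' : ℝ → X}

theorem HasTimeDeriv.intervalIntegrable (h : HasTimeDeriv T u u') {a b : ℝ}
    (ha : a ∈ Ioo 0 T) (hb : b ∈ Ioo 0 T) : IntervalIntegrable u' volume a b :=
  (h.1.integrableOn_compact_subset (ordConnected_Ioo.uIcc_subset ha hb)
    isCompact_uIcc).intervalIntegrable

theorem HasTimeDeriv.absolutelyContinuousOnInterval (h : HasTimeDeriv T u u') {a b : ℝ}
    (ha : a ∈ Ioo 0 T) (hb : b ∈ Ioo 0 T) : AbsolutelyContinuousOnInterval u a b :=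
  (h.intervalIntegrable ha hb).absolutelyContinuousOnInterval_of_sub_eq fun x hx y hy =>
    h.2 x (ordConnected_Ioo.uIcc_subset ha hb hx) y (ordConnected_Ioo.uIcc_subset ha hb hy)

/-- Lebesgue differentiation of the primitive based at a. The increment formula holds on all of
(0,T), a neighbourhood of t, so the derivative is two-sided even at the ends of the interval. -/
theorem HasTimeDeriv.ae_hasDerivAt [CompleteSpace X] (h : HasTimeDeriv T u u') {a b : ℝ}
    (ha : a ∈ Ioo 0 T) (hb : b ∈ Ioo 0 T) :
    ∀ᵐ t, t ∈ uIcc a b → HasDerivAt u (u' t) t := by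
  filter_upwards [(h.intervalIntegrable ha hb).ae_hasDerivAt_integral] with t ht hmem
  have hd := (ht hmem a left_mem_uIcc).const_add (u a)
  have htT : t ∈ Ioo 0 T := ordConnected_Ioo.uIcc_subset ha hb hmem
  refine hd.congr_of_eventuallyEq ?_
  filter_upwards [isOpen_Ioo.mem_nhds htT] with y hy
  rw [← h.2 a ha y hy]
  abel

end TimeDerivative

/-! ### Bounded bilinear maps from Hölder's inequality. -/

section Pairing

variable {α : Type*} [MeasurableSpace α] {ν : Measure α}

instance holderTriple_four_four_two : ENNReal.HolderTriple 4 4 2 where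
  inv_add_inv_eq_inv := by
    rw [← two_mul, show (4 : ℝ≥0∞) = 2 * 2 by norm_num,
      ENNReal.mul_inv (by norm_num) (by norm_num), ← mul_assoc,
      ENNReal.mul_inv_cancel (by norm_num) (by norm_num), one_mul]

variable (ν) in
/-- Multiplication `L⁴ × L⁴ → L²`. -/
noncomputable def mulL : Lp ℝ 4 ν →L[ℝ] Lp ℝ 4 ν →L[ℝ] Lp ℝ 2 ν :=
  (ContinuousLinearMap.mul ℝ ℝ).holderL ν 4 4 2

theorem coeFn_mulL (f g : Lp ℝ 4 ν) : mulL ν f g =ᵐ[ν] fun z => f z * g z :=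
  (ContinuousLinearMap.mul ℝ ℝ).coeFn_holder f g

/-- The weighted pairing `∫ w f g` on `L²`, for a bounded weight `w`. -/
noncomputable def weightedPairing {w : α → ℝ} (hw : MemLp w ∞ ν) :
    Lp ℝ 2 ν →L[ℝ] Lp ℝ 2 ν →L[ℝ] ℝ :=
  (ContinuousLinearMap.mul ℝ ℝ).lpPairing ν 2 2 ∘L
    (ContinuousLinearMap.mul ℝ ℝ).holderL ν ∞ 2 2 (hw.toLp w)

variable {w : α → ℝ} (hw : MemLp w ∞ ν)

theorem weightedPairing_apply (f g : Lp ℝ 2 ν) :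
    weightedPairing hw f g = ∫ z, w z * f z * g z ∂ν := by
  have h : weightedPairing hw f g = ∫ z, ContinuousLinearMap.mul ℝ ℝ
      ((ContinuousLinearMap.mul ℝ ℝ).holder 2 (hw.toLp w) f z) (g z) ∂ν :=
    (ContinuousLinearMap.mul ℝ ℝ).lpPairing_eq_integral _ _
  rw [h]
  refine integral_congr_ae ?_
  filter_upwards [(ContinuousLinearMap.mul ℝ ℝ).coeFn_holder (r := 2) (hw.toLp w) f,
    hw.coeFn_toLp] with z h1 h2
  rw [h1, h2]
  rfl

theorem weightedPairing_comm (f g : Lp ℝ 2 ν) :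
    weightedPairing hw f g = weightedPairing hw g f := by
  rw [weightedPairing_apply, weightedPairing_apply]
  exact integral_congr_ae (.of_forall fun z => by ring)

theorem integrable_weight_mul_mul {w : α → ℝ} (hw : MemLp w ∞ ν) (f g : Lp ℝ 2 ν) :
    Integrable (fun z => w z * f z * g z) ν := by
  have h : MemLp (fun z => w z * f z) 2 ν := (Lp.memLp f).mul hw
  exact h.integrable_mul (Lp.memLp g)

end Pairing

end KerrTE

namespace KerrTE

/-! ### The energy as a smooth functional of the fields. -/

section EnergyFunctional

variable {α : Type*} [MeasurableSpace α] {ν : Measure α}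

/-- The intensity `|E|² = Ex² + Ey²` as an element of `L²`. -/
noncomputable def intensity (F G : Lp ℝ 4 ν) : Lp ℝ 2 ν := mulL ν F F + mulL ν G G

theorem coeFn_intensity (F G : Lp ℝ 4 ν) :
    intensity F G =ᵐ[ν] fun z => F z ^ 2 + G z ^ 2 := by
  filter_upwards [Lp.coeFn_add (mulL ν F F) (mulL ν G G), coeFn_mulL F F, coeFn_mulL G G]
    with z h1 h2 h3
  rw [intensity, h1, Pi.add_apply, h2, h3]
  ring

/-- The derivative of `intensity` at `(F, G)` in the direction `(F', G')`. -/
noncomputable def intensityDeriv (F G F' G' : Lp ℝ 4 ν) : Lp ℝ 2 ν :=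
  (mulL ν F F' + mulL ν F' F) + (mulL ν G G' + mulL ν G' G)

theorem coeFn_intensityDeriv (F G F' G' : Lp ℝ 4 ν) :
    intensityDeriv F G F' G' =ᵐ[ν] fun z => 2 * (F z * F' z + G z * G' z) := by
  filter_upwards [Lp.coeFn_add (mulL ν F F' + mulL ν F' F) (mulL ν G G' + mulL ν G' G),
    Lp.coeFn_add (mulL ν F F') (mulL ν F' F), Lp.coeFn_add (mulL ν G G') (mulL ν G' G),
    coeFn_mulL F F', coeFn_mulL F' F, coeFn_mulL G G', coeFn_mulL G' G]
    with z h1 h2 h3 h4 h5 h6 h7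
  rw [intensityDeriv, h1, Pi.add_apply, h2, h3, Pi.add_apply, Pi.add_apply, h4, h5, h6, h7]
  ring

theorem hasDerivAt_intensity {F G : ℝ → Lp ℝ 4 ν} {F' G' : Lp ℝ 4 ν} {t : ℝ}
    (hF : HasDerivAt F F' t) (hG : HasDerivAt G G' t) :
    HasDerivAt (fun τ => intensity (F τ) (G τ)) (intensityDeriv (F t) (G t) F' G') t :=
  ((mulL ν).hasDerivAt_of_bilinear (fun _ => hF) (fun _ => hF)).add
    ((mulL ν).hasDerivAt_of_bilinear (fun _ => hG) (fun _ => hG))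

theorem continuous_intensity :
    Continuous fun P : Lp ℝ 4 ν × Lp ℝ 4 ν => intensity P.1 P.2 := by
  unfold intensity
  fun_prop

variable [IsFiniteMeasure ν]

variable (ν) in
/-- The constant function `1` in `L²`. -/
noncomputable def oneL2 : Lp ℝ 2 ν := (memLp_const (1 : ℝ)).toLp _

theorem coeFn_oneL2 : oneL2 ν =ᵐ[ν] fun _ => (1 : ℝ) := MemLp.coeFn_toLp _

variable {w₁ w₂ w₃ : α → ℝ}
  (h₁ : MemLp w₁ ∞ ν) (h₂ : MemLp w₂ ∞ ν) (h₃ : MemLp w₃ ∞ ν)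

/-- The energy `∫ w₁ |E|² + ∫ w₂ H² + (3/2) ∫ w₃ |E|⁴` as a functional on `L⁴ × L⁴ × L²`. -/
noncomputable def energyFunctional (F G : Lp ℝ 4 ν) (H : Lp ℝ 2 ν) : ℝ :=
  weightedPairing h₁ (oneL2 ν) (intensity F G) + weightedPairing h₂ H H
    + (3 / 2 : ℝ) • weightedPairing h₃ (intensity F G) (intensity F G)

/-- Needed to pass to t = 0, where only continuity of the fields is available. -/
theorem continuous_energyFunctional :
    Continuous fun P : (Lp ℝ 4 ν × Lp ℝ 4 ν) × Lp ℝ 2 ν =>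
      energyFunctional h₁ h₂ h₃ P.1.1 P.1.2 P.2 := by
  have hS : Continuous fun P : (Lp ℝ 4 ν × Lp ℝ 4 ν) × Lp ℝ 2 ν => intensity P.1.1 P.1.2 :=
    continuous_intensity.comp continuous_fst
  unfold energyFunctional
  fun_prop

theorem absolutelyContinuousOnInterval_energyFunctional {F G : ℝ → Lp ℝ 4 ν}
    {H : ℝ → Lp ℝ 2 ν} {a b : ℝ} (hF : AbsolutelyContinuousOnInterval F a b)
    (hG : AbsolutelyContinuousOnInterval G a b) (hH : AbsolutelyContinuousOnInterval H a b) :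
    AbsolutelyContinuousOnInterval (fun t => energyFunctional h₁ h₂ h₃ (F t) (G t) (H t)) a b := by
  have hS : AbsolutelyContinuousOnInterval (fun t => intensity (F t) (G t)) a b :=
    ((mulL ν).absolutelyContinuousOnInterval_of_bilinear hF hF).add
      ((mulL ν).absolutelyContinuousOnInterval_of_bilinear hG hG)
  have hone : AbsolutelyContinuousOnInterval (fun _ : ℝ => oneL2 ν) a b :=
    (LipschitzWith.const (oneL2 ν)).lipschitzOnWith.absolutelyContinuousOnInterval
  exact (((weightedPairing h₁).absolutelyContinuousOnInterval_of_bilinear hone hS).add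
    ((weightedPairing h₂).absolutelyContinuousOnInterval_of_bilinear hH hH)).add
    (((weightedPairing h₃).absolutelyContinuousOnInterval_of_bilinear hS hS).const_smul (3 / 2 : ℝ))

/-- Product rule for symmetric forms: each quadratic term doubles, so 3/2 becomes 3. -/
theorem hasDerivAt_energyFunctional {F G : ℝ → Lp ℝ 4 ν} {H : ℝ → Lp ℝ 2 ν}
    {F' G' : Lp ℝ 4 ν} {H' : Lp ℝ 2 ν} {t : ℝ}
    (hF : HasDerivAt F F' t) (hG : HasDerivAt G G' t) (hH : HasDerivAt H H' t) :
    HasDerivAt (fun τ => energyFunctional h₁ h₂ h₃ (F τ) (G τ) (H τ))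
      (weightedPairing h₁ (oneL2 ν) (intensityDeriv (F t) (G t) F' G')
        + 2 * weightedPairing h₂ H' (H t)
        + 3 * weightedPairing h₃ (intensity (F t) (G t)) (intensityDeriv (F t) (G t) F' G')) t := by
  have hS := hasDerivAt_intensity hF hG
  have d₁ := (weightedPairing h₁ (oneL2 ν)).hasFDerivAt.comp_hasDerivAt t hS
  have d₂ := (weightedPairing h₂).hasDerivAt_of_bilinear (fun _ => hH) (fun _ => hH)
  have d₃ := ((weightedPairing h₃).hasDerivAt_of_bilinear (fun _ => hS) (fun _ => hS)).const_smul (3 / 2 : ℝ)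
  refine ((d₁.add d₂).add d₃).congr_deriv ?_
  rw [weightedPairing_comm h₂ (H t) H', weightedPairing_comm h₃ (intensityDeriv _ _ _ _)]
  simp only [smul_eq_mul]
  ring

end EnergyFunctional

/-! ### Energy balance for weak solutions. -/

section KerrEnergy

variable {Ω : Set (ℝ × ℝ)} {ε₀ : ℝ} {μ₀ χ₁ χ₃ : ℝ × ℝ → ℝ}

/-- The sign of w matters because `Real.sqrt` sends negative integrals to 0. -/
theorem sq_wnorm {w : ℝ × ℝ → ℝ} (hw : ∀ᵐ z ∂(volume.restrict Ω), 0 ≤ w z) (f : ℝ × ℝ → ℝ) :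
    wnorm Ω w f ^ 2 = ∫ z in Ω, |f z| ^ 2 * w z := by
  refine Real.sq_sqrt (integral_nonneg_of_ae ?_)
  filter_upwards [hw] with z hz
  exact mul_nonneg (sq_nonneg _) hz

variable [IsFiniteMeasure ((volume : Measure (ℝ × ℝ)).restrict Ω)]

theorem energyFunctional_eq_energy
    (h₁ : MemLp (fun z => ε₀ * (1 + χ₁ z)) ∞ (volume.restrict Ω))
    (h₂ : MemLp μ₀ ∞ (volume.restrict Ω))
    (h₃ : MemLp (fun z => ε₀ * χ₃ z) ∞ (volume.restrict Ω))
    (p₁ : ∀ᵐ z ∂(volume.restrict Ω), 0 ≤ ε₀ * (1 + χ₁ z))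
    (p₂ : ∀ᵐ z ∂(volume.restrict Ω), 0 ≤ μ₀ z)
    (p₃ : ∀ᵐ z ∂(volume.restrict Ω), 0 ≤ ε₀ * χ₃ z)
    (F G : LSpace 4 Ω) (H : LSpace 2 Ω) :
    energyFunctional h₁ h₂ h₃ F G H = energy Ω ε₀ μ₀ χ₁ χ₃ F G H := by
  rw [energyFunctional, energy, sq_wnorm p₁, sq_wnorm p₂, sq_wnorm p₃, weightedPairing_apply,
    weightedPairing_apply, weightedPairing_apply, smul_eq_mul]
  congr 1
  · congr 1
    · refine integral_congr_ae ?_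
      filter_upwards [coeFn_oneL2 (ν := volume.restrict Ω), coeFn_intensity F G] with z e1 e2
      rw [e1, e2, sq_abs, Real.sq_sqrt (by positivity)]
      ring
    · refine integral_congr_ae (.of_forall fun z => ?_)
      simp only [sq_abs]
      ring
  · congr 1
    refine integral_congr_ae ?_
    filter_upwards [coeFn_intensity F G] with z e
    rw [e, sq_abs]
    ring

/-- The work of `∂ₜD` against `E` in terms of the intensity. -/
theorem integral_dtD_mul (h₁ : MemLp (fun z => ε₀ * (1 + χ₁ z)) ∞ (volume.restrict Ω))
    (h₃ : MemLp (fun z => ε₀ * χ₃ z) ∞ (volume.restrict Ω)) (F G F' G' : LSpace 4 Ω) :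
    2 * ∫ z in Ω, (dtDx ε₀ χ₁ χ₃ F G F' G' z * F z + dtDy ε₀ χ₁ χ₃ F G F' G' z * G z)
      = weightedPairing h₁ (oneL2 _) (intensityDeriv F G F' G')
        + 3 * weightedPairing h₃ (intensity F G) (intensityDeriv F G F' G') := by
  rw [weightedPairing_apply, weightedPairing_apply, ← integral_const_mul, ← integral_const_mul,
    ← integral_add (integrable_weight_mul_mul h₁ _ _)
      ((integrable_weight_mul_mul h₃ _ _).const_mul 3)]
  refine integral_congr_ae ?_
  filter_upwards [coeFn_oneL2 (ν := volume.restrict Ω), coeFn_intensity F G,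
    coeFn_intensityDeriv F G F' G'] with z e1 e2 e3
  -- Pointwise, ∂ₜD·E = ε₀((1 + χ₁) + 3χ₃|E|²) E·∂ₜE, and the outer factor 2 turns E·∂ₜE into half
  -- of nothing less than ∂ₜ|E|² = 2E·∂ₜE.
  rw [e1, e2, e3, dtDx, dtDy]
  ring

/-- Testing the equations with the solution itself, the rate of change of the energy vanishes. -/
theorem energy_rate_eq_zero
    (h₁ : MemLp (fun z => ε₀ * (1 + χ₁ z)) ∞ (volume.restrict Ω))
    (h₂ : MemLp μ₀ ∞ (volume.restrict Ω))
    (h₃ : MemLp (fun z => ε₀ * χ₃ z) ∞ (volume.restrict Ω))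
    {F G F' G' : LSpace 4 Ω} {H H' c : LSpace 2 Ω}
    (hD : ∫ z in Ω, (dtDx ε₀ χ₁ χ₃ F G F' G' z * F z + dtDy ε₀ χ₁ χ₃ F G F' G' z * G z)
      = (∫ z in Ω, H z * c z)
        + ∫ z in Ω, ((0 : LSpace 2 Ω) z * F z + (0 : LSpace 2 Ω) z * G z))
    (hH : ∫ z in Ω, μ₀ z * H' z * H z = - ∫ z in Ω, c z * H z) :
    weightedPairing h₁ (oneL2 _) (intensityDeriv F G F' G') + 2 * weightedPairing h₂ H' H
      + 3 * weightedPairing h₃ (intensity F G) (intensityDeriv F G F' G') = 0 := by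
  have hJ : ∫ z in Ω, ((0 : LSpace 2 Ω) z * F z + (0 : LSpace 2 Ω) z * G z) = 0 := by
    refine integral_eq_zero_of_ae ?_
    filter_upwards [Lp.coeFn_zero ℝ 2 (volume.restrict Ω)] with z hz
    rw [hz, Pi.zero_apply, zero_mul, zero_mul, add_zero]
  have hcomm : ∫ z in Ω, H z * c z = ∫ z in Ω, c z * H z :=
    integral_congr_ae (.of_forall fun z => mul_comm _ _)
  rw [← weightedPairing_apply h₂] at hH
  have hW := integral_dtD_mul h₁ h₃ F G F' G'
  linarith

/-- The exceptional null set of times does not depend on the test functions, so the time-dependent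
choice Φ = E(τ), Ψ = H(τ) is legitimate; the PEC condition on E(τ) makes Φ admissible. -/
theorem IsWeakSolution.energyFunctional_eq_of_mem_Ioo {T : ℝ}
    (h₁ : MemLp (fun z => ε₀ * (1 + χ₁ z)) ∞ (volume.restrict Ω))
    (h₂ : MemLp μ₀ ∞ (volume.restrict Ω))
    (h₃ : MemLp (fun z => ε₀ * χ₃ z) ∞ (volume.restrict Ω))
    {Ex₀ Ey₀ : LSpace 4 Ω} {Hz₀ : LSpace 2 Ω} {Ex Ey : ℝ → LSpace 4 Ω} {Hz : ℝ → LSpace 2 Ω}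
    (hsol : IsWeakSolution Ω T ε₀ μ₀ χ₁ χ₃ 0 0 Ex₀ Ey₀ Hz₀ Ex Ey Hz) {a b : ℝ}
    (ha : a ∈ Ioo 0 T) (hb : b ∈ Ioo 0 T) :
    energyFunctional h₁ h₂ h₃ (Ex a) (Ey a) (Hz a)
      = energyFunctional h₁ h₂ h₃ (Ex b) (Ey b) (Hz b) := by
  obtain ⟨-, -, -, -, -, -, Ex', Ey', Hz', dEx, dEy, dHz, heq⟩ := hsol
  have hac := absolutelyContinuousOnInterval_energyFunctional h₁ h₂ h₃
    (dEx.absolutelyContinuousOnInterval ha hb) (dEy.absolutelyContinuousOnInterval ha hb)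
    (dHz.absolutelyContinuousOnInterval ha hb)
  obtain ⟨C, hC⟩ := hac.const_of_ae_hasDerivAt_zero (by
    filter_upwards [dEx.ae_hasDerivAt ha hb, dEy.ae_hasDerivAt ha hb, dHz.ae_hasDerivAt ha hb,
      (ae_restrict_iff' measurableSet_Ioo).1 heq] with τ d1 d2 d3 hτ hmem
    obtain ⟨hD, c, hc, hH⟩ := hτ (ordConnected_Ioo.uIcc_subset ha hb hmem)
    have hd := hasDerivAt_energyFunctional h₁ h₂ h₃ (d1 hmem) (d2 hmem) (d3 hmem)
    rwa [energy_rate_eq_zero h₁ h₂ h₃ (hD (Ex τ) (Ey τ) c hc) (hH (Hz τ))] at hd)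
  rw [hC a left_mem_uIcc, hC b right_mem_uIcc]

/-- Let the other time in (0,T) tend to 0: a constant function has the initial energy as its limit.
-/
theorem IsWeakSolution.energyFunctional_eq {T : ℝ}
    (h₁ : MemLp (fun z => ε₀ * (1 + χ₁ z)) ∞ (volume.restrict Ω))
    (h₂ : MemLp μ₀ ∞ (volume.restrict Ω))
    (h₃ : MemLp (fun z => ε₀ * χ₃ z) ∞ (volume.restrict Ω))
    {Ex₀ Ey₀ : LSpace 4 Ω} {Hz₀ : LSpace 2 Ω} {Ex Ey : ℝ → LSpace 4 Ω} {Hz : ℝ → LSpace 2 Ω}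
    (hsol : IsWeakSolution Ω T ε₀ μ₀ χ₁ χ₃ 0 0 Ex₀ Ey₀ Hz₀ Ex Ey Hz) {t : ℝ} (ht : t ∈ Ico 0 T) :
    energyFunctional h₁ h₂ h₃ (Ex t) (Ey t) (Hz t)
      = energyFunctional h₁ h₂ h₃ (Ex 0) (Ey 0) (Hz 0) := by
  rcases ht.1.eq_or_lt with rfl | ht0
  · rfl
  have hT : 0 < T := ht0.trans ht.2
  have hpair : ContinuousOn (fun τ => ((Ex τ, Ey τ), Hz τ)) (Ico 0 T) :=
    (hsol.1.prodMk hsol.2.1).prodMk hsol.2.2.1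
  have hlim : Filter.Tendsto (fun τ => ((Ex τ, Ey τ), Hz τ)) (nhdsWithin 0 (Ioo 0 T))
      (nhds ((Ex 0, Ey 0), Hz 0)) :=
    (hpair 0 ⟨le_rfl, hT⟩).mono Ioo_subset_Ico_self
  have hlim' := ((continuous_energyFunctional h₁ h₂ h₃).tendsto ((Ex 0, Ey 0), Hz 0)).comp hlim
  have : (nhdsWithin (0 : ℝ) (Ioo 0 T)).NeBot := by
    rw [nhdsWithin_Ioo_eq_nhdsGT hT]
    infer_instance
  refine tendsto_nhds_unique (tendsto_const_nhds.congr' ?_) hlim'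
  filter_upwards [self_mem_nhdsWithin] with τ hτ
  exact hsol.energyFunctional_eq_of_mem_Ioo h₁ h₂ h₃ ⟨ht0, ht.2⟩ hτ

end KerrEnergy

end KerrTE

theorem mainTheorem4
    (r s p q T ε₀ : ℝ) (hrs : r < s) (hpq : p < q) (hT : 0 < T) (hε₀ : 0 < ε₀)
    (μ₀ χ₁ χ₃ : ℝ × ℝ → ℝ)
    (hμ₀ : MemLp μ₀ ∞ (volume.restrict (KerrTE.rect r s p q)))
    (hχ₁ : MemLp χ₁ ∞ (volume.restrict (KerrTE.rect r s p q)))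
    (hχ₃ : MemLp χ₃ ∞ (volume.restrict (KerrTE.rect r s p q)))
    (hμ₀_pos : ∀ z ∈ KerrTE.rect r s p q, 0 < μ₀ z)
    (hχ₁_pos : ∀ z ∈ KerrTE.rect r s p q, 0 < χ₁ z)
    (hχ₃_pos : ∀ z ∈ KerrTE.rect r s p q, 0 < χ₃ z)
    (Ex₀ Ey₀ : KerrTE.LSpace 4 (KerrTE.rect r s p q))
    (Hz₀ : KerrTE.LSpace 2 (KerrTE.rect r s p q))
    (Ex Ey : ℝ → KerrTE.LSpace 4 (KerrTE.rect r s p q))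
    (Hz : ℝ → KerrTE.LSpace 2 (KerrTE.rect r s p q))
    (hsol : KerrTE.IsWeakSolution (KerrTE.rect r s p q) T ε₀ μ₀ χ₁ χ₃ 0 0
      Ex₀ Ey₀ Hz₀ Ex Ey Hz) :
    ∀ t ∈ Ico 0 T,
      KerrTE.energy (KerrTE.rect r s p q) ε₀ μ₀ χ₁ χ₃ (Ex t) (Ey t) (Hz t)
          = KerrTE.energy (KerrTE.rect r s p q) ε₀ μ₀ χ₁ χ₃ (Ex 0) (Ey 0) (Hz 0) ∧
      KerrTE.energy (KerrTE.rect r s p q) ε₀ μ₀ χ₁ χ₃ (Ex 0) (Ey 0) (Hz 0)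
          = KerrTE.energy (KerrTE.rect r s p q) ε₀ μ₀ χ₁ χ₃ Ex₀ Ey₀ Hz₀ := by
  have hm : MeasurableSet (KerrTE.rect r s p q) := measurableSet_Ioo.prod measurableSet_Ioo
  -- Finite area puts the constant 1 in L², so that ∫ w|E|² is a pairing of 1 with |E|².
  have : IsFiniteMeasure ((volume : Measure (ℝ × ℝ)).restrict (KerrTE.rect r s p q)) := by
    refine isFiniteMeasure_restrict.2 (ne_of_lt ?_)
    rw [KerrTE.rect, Measure.volume_eq_prod, Measure.prod_prod]
    simp [ENNReal.mul_lt_top]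
  have h₁ : MemLp (fun z => ε₀ * (1 + χ₁ z)) ∞ (volume.restrict (KerrTE.rect r s p q)) :=
    ((memLp_const (1 : ℝ)).add hχ₁).const_mul ε₀
  have h₃ : MemLp (fun z => ε₀ * χ₃ z) ∞ (volume.restrict (KerrTE.rect r s p q)) :=
    hχ₃.const_mul ε₀
  have hE := KerrTE.energyFunctional_eq_energy h₁ hμ₀ h₃
    (ae_restrict_of_forall_mem hm fun z hz => by have := hχ₁_pos z hz; positivity)
    (ae_restrict_of_forall_mem hm fun z hz => (hμ₀_pos z hz).le)
    (ae_restrict_of_forall_mem hm fun z hz => by have := hχ₃_pos z hz; positivity)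
  intro t ht
  obtain ⟨-, -, -, hEx, hEy, hHz, -⟩ := id hsol
  refine ⟨?_, by rw [hEx, hEy, hHz]⟩
  rw [← hE, ← hE]
  exact hsol.energyFunctional_eq h₁ hμ₀ h₃ ht
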